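/- Let $n\ge 1$, let $H_0\in\mathbb C^{n\times n}$ be Hermitian with orthonormal eigenbasis $|1\rangle,\dots,|n\rangle$, $H_0|k\rangle=E_k|k\rangle$, $E_1\le\dots\le E_n$, and assume that the energies are equidistant, i.e. $E_{k+1}-E_k$ is the same for all $1\le k<n$. Let $T\in(0,\infty]$ (with $1/\infty:=0$) and let $d:=\big(e^{-E_k/T}\big)_{k=1}^n/\sum_{k=1}^n e^{-E_k/T}$ be the Gibbs vector. Set $\theta_k:=\arccos\big((1+d_{k+1}/d_k)^{-1/2}\big)$, $$\sigma_+^d:=\sum_{k=1}^{n-1}\sqrt{k(n-k)}\cos(\theta_k)\,|k\rangle\langle k+1|,\qquad \sigma_-^d:=\sum_{k=1}^{n-1}\sqrt{k(n-k)}\sin(\theta_k)\,|k+1\rangle\langle k|,$$ $\mathbf\Gamma_V(\rho):=\tfrac12(V^\dagger V\rho+\rho V^\dagger V)-V\rho V^\dagger$ and $\mathbf\Gamma_d:=\mathbf\Gamma_{\sigma_+^d}+\mathbf\Gamma_{\sigma_-^d}$. Let $B\in\mathbb R^{n\times n}$, $B_{ij}:=\langle i|\mathbf\Gamma_d(|j\rangle\langle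 j|)|i\rangle$, be the restriction of $\mathbf\Gamma_d$ to diagonal matrices. The toy model $\Lambda_d$ is the following hybrid control system on the standard simplex $\Delta^{n-1}=\{x\in\mathbb R^n: x\ge 0,\ \sum_i x_i=1\}$. The controls are switching times $0=t_0\le t_1\le t_2\le\dots$ with $t_k\to\infty$ and permutations $\pi_k\in S_n$ (acting on vectors by permuting entries); given $x_0\in\Delta^{n-1}$, a solution satisfies $$x(t_k)=\pi_k x_k,\qquad \dot x(t)=-Bx(t)\ \text{ for } t\in[t_k,t_{k+1}),\qquad x_{k+1}=e^{-(t_{k+1}-t_k)B}\,\pi_k x_k ,\qquad k\ge 0$$ (where, if $t_k=t_{k+1}$, only the last relation is required). Let $\mathfrak{reach}_{\Lambda_d}(x_0)$ be the set of all $x(t)$, $t\ge 0$, over all such solutions. For $x,y\in\mathbb R^n$ write $x\prec y$ if $x=Ay$ for some doubly stochastic matrix $A$, and let $M_{\mathbb e}(z)$ be the set of all $Az$ with $A$ entrywise nonnegative, with column sums $1$ and $A\mathbb e=\mathbb e$, where $\mathbb e=(1,\dots,1)^\top$. Two vectors $u,v\in\mathbb R^n$ are ordered likewise if there is one $\pi\in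 S_n$ with $u_{\pi(1)}\ge\dots\ge u_{\pi(n)}$ and $v_{\pi(1)}\ge\dots\ge v_{\pi(n)}$. The ordered past cone of $x_0$ is $$C(x_0):=\big\{z\in\Delta^{n-1}: x_0\prec z\ \text{ and }\ d \text{ and } (z_i/d_i)_{i=1}^n \text{ are ordered likewise}\big\}.$$ Then for every $x_0\in\Delta^{n-1}$ and every $z\in C(x_0)$, $$\overline{\mathfrak{reach}_{\Lambda_d}(x_0)}\subseteq\operatorname{conv}\{\pi(z):\pi\in S_n\}=M_{\mathbb e}(z).$$ Moreover, if all entries of $x_0$ are strictly positive, then $C(x_0)$ contains some $z$ all of whose entries are strictly positive. -/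

import Mathlib

open scoped ENNReal Matrix

noncomputable section

namespace ToyModel

variable {n : ℕ}

/-! ### Majorisation -/

/-- Action of a permutation on the entries of a vector. -/
def permute (π : Equiv.Perm (Fin n)) (x : Fin n → ℝ) : Fin n → ℝ := fun i => x (π i)

/-- Classical majorisation `x ≺ y`: `x = A y` for some doubly stochastic matrix `A`. -/
def Majorised (x y : Fin n → ℝ) : Prop :=
  ∃ A ∈ doublyStochastic ℝ (Fin n), A *ᵥ y = x

/-- `A` is `d`-stochastic: entrywise nonnegative, all columns sum to `1`, and `A d = d`. -/
def IsDStochastic (d : Fin n → ℝ) (A : Matrix (Fin n) (Fin n) ℝ) : Prop :=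
  (∀ i j, 0 ≤ A i j) ∧ (∀ j, ∑ i, A i j = 1) ∧ A *ᵥ d = d

/-- The `d`-majorisation polytope `M_d(y) = {A y : A is d-stochastic}`. -/
def dMajPolytope (d y : Fin n → ℝ) : Set (Fin n → ℝ) :=
  {x | ∃ A : Matrix (Fin n) (Fin n) ℝ, IsDStochastic d A ∧ A *ᵥ y = x}

/-- Two vectors are ordered likewise: one permutation sorts both of them non-increasingly. -/
def OrderedLikewise (u v : Fin n → ℝ) : Prop :=
  ∃ π : Equiv.Perm (Fin n), Antitone (fun k => u (π k)) ∧ Antitone (fun k => v (π k))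

/-- The ordered past cone of `x₀` with respect to `d`. -/
def orderedPastCone (d x₀ : Fin n → ℝ) : Set (Fin n → ℝ) :=
  {z | z ∈ stdSimplex ℝ (Fin n) ∧ Majorised x₀ z ∧ OrderedLikewise d (fun i => z i / d i)}

/-! ### The thermal dissipator -/

/-- Consecutive energies differ by one and the same gap. -/
def Equidistant (E : Fin n → ℝ) : Prop :=
  ∃ Δ : ℝ, ∀ (k : ℕ) (h : k + 1 < n), E ⟨k + 1, h⟩ - E ⟨k, by omega⟩ = Δ

/-- The Gibbs vector `d_k = e^{-E_k/T} / ∑_j e^{-E_j/T}` at temperature `T ∈ (0,∞]`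
(with `1/∞ = 0`). -/
def gibbs (E : Fin n → ℝ) (T : ℝ≥0∞) : Fin n → ℝ :=
  fun k => Real.exp (-(E k * T⁻¹.toReal)) / ∑ j, Real.exp (-(E j * T⁻¹.toReal))

/-- The operator `|j⟩⟨k|` for the orthonormal basis `b`. -/
def ketBra (b : OrthonormalBasis (Fin n) ℂ (EuclideanSpace ℂ (Fin n))) (j k : Fin n) :
    Matrix (Fin n) (Fin n) ℂ :=
  Matrix.vecMulVec (b j).ofLp (star (b k).ofLp)

/-- The thermal angle `θ = arccos((1 + d_l / d_k)^{-1/2})`, used for `l = k + 1`. -/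
def thermalAngle (d : Fin n → ℝ) (k l : Fin n) : ℝ :=
  Real.arccos ((1 + d l / d k) ^ (-(1 / 2) : ℝ))

/-- `σ₊^d = ∑_{k=1}^{n-1} √(k(n-k)) cos(θ_k) |k⟩⟨k+1|`
(the summation index is shifted by one, since `Fin n` starts at `0`). -/
def sigmaPlus (b : OrthonormalBasis (Fin n) ℂ (EuclideanSpace ℂ (Fin n))) (d : Fin n → ℝ) :
    Matrix (Fin n) (Fin n) ℂ :=
  ∑ k : Fin n, if h : (k : ℕ) + 1 < n then
    ((Real.sqrt (((k : ℝ) + 1) * ((n : ℝ) - ((k : ℝ) + 1)))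
      * Real.cos (thermalAngle d k ⟨k + 1, h⟩) : ℝ) : ℂ) • ketBra b k ⟨k + 1, h⟩
  else 0

/-- `σ₋^d = ∑_{k=1}^{n-1} √(k(n-k)) sin(θ_k) |k+1⟩⟨k|` (same index shift). -/
def sigmaMinus (b : OrthonormalBasis (Fin n) ℂ (EuclideanSpace ℂ (Fin n))) (d : Fin n → ℝ) :
    Matrix (Fin n) (Fin n) ℂ :=
  ∑ k : Fin n, if h : (k : ℕ) + 1 < n then
    ((Real.sqrt (((k : ℝ) + 1) * ((n : ℝ) - ((k : ℝ) + 1)))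
      * Real.sin (thermalAngle d k ⟨k + 1, h⟩) : ℝ) : ℂ) • ketBra b ⟨k + 1, h⟩ k
  else 0

/-- The GKSL dissipator of one operator `V`:
`Γ_V(ρ) = ½ (V†V ρ + ρ V†V) - V ρ V†`. -/
def gksl (V ρ : Matrix (Fin n) (Fin n) ℂ) : Matrix (Fin n) (Fin n) ℂ :=
  (1 / 2 : ℂ) • (Vᴴ * V * ρ + ρ * (Vᴴ * V)) - V * ρ * Vᴴ

/-- The thermal dissipator `Γ_d = Γ_{σ₊^d} + Γ_{σ₋^d}`. -/
def thermalDissipator (b : OrthonormalBasis (Fin n) ℂ (EuclideanSpace ℂ (Fin n)))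
    (d : Fin n → ℝ) (ρ : Matrix (Fin n) (Fin n) ℂ) : Matrix (Fin n) (Fin n) ℂ :=
  gksl (sigmaPlus b d) ρ + gksl (sigmaMinus b d) ρ

/-- The restriction `B` of `Γ_d` to the diagonal in the basis `b`: the matrix with entries
`B_ij = ⟨i| Γ_d(|j⟩⟨j|) |i⟩`, so that `B x` is the diagonal of `Γ_d(∑_j x_j |j⟩⟨j|)`. -/
def generator (b : OrthonormalBasis (Fin n) ℂ (EuclideanSpace ℂ (Fin n))) (d : Fin n → ℝ) :
    Matrix (Fin n) (Fin n) ℝ :=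
  Matrix.of fun i j =>
    (star (b i).ofLp ⬝ᵥ (thermalDissipator b d (ketBra b j j) *ᵥ (b i).ofLp)).re

/-! ### The hybrid control system -/

/-- `x` is a solution on `[0,∞)` of the hybrid system `Λ_B` starting at `x₀`. There are switching
times `0 = t 0 ≤ t 1 ≤ …` which do not accumulate, permutations `π k` and states `y k` before
the `k`-th switch (`y 0 = x₀`) such that `x (t k) = π k (y k)`, `x' = -B x` on
`[t k, t (k+1))` and `y (k+1) = e^{-(t (k+1) - t k) B} π k (y k)`. If `t k = t (k+1)`, the
interval is empty and the two permutations are applied at once. -/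
def IsSolution (B : Matrix (Fin n) (Fin n) ℝ) (x₀ : Fin n → ℝ) (x : ℝ → Fin n → ℝ) : Prop :=
  ∃ (t : ℕ → ℝ) (π : ℕ → Equiv.Perm (Fin n)) (y : ℕ → Fin n → ℝ),
    t 0 = 0 ∧ Monotone t ∧ Filter.Tendsto t Filter.atTop Filter.atTop ∧
    y 0 = x₀ ∧
    (∀ k, y (k + 1) = NormedSpace.exp (-(t (k + 1) - t k) • B) *ᵥ permute (π k) (y k)) ∧
    ∀ k, t k < t (k + 1) →
      x (t k) = permute (π k) (y k) ∧
      ∀ s ∈ Set.Ico (t k) (t (k + 1)),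
        HasDerivWithinAt x (-(B *ᵥ x s)) (Set.Ico (t k) (t (k + 1))) s

/-- The reachable set of `x₀` under `Λ_B`. -/
def reach (B : Matrix (Fin n) (Fin n) ℝ) (x₀ : Fin n → ℝ) : Set (Fin n → ℝ) :=
  {w | ∃ x : ℝ → Fin n → ℝ, IsSolution B x₀ x ∧ ∃ s : ℝ, 0 ≤ s ∧ x s = w}

end ToyModel

end

namespace ToyModel

/-! The permutohedron of `z` contains `x₀` by Birkhoff's theorem and is closed and stable under
permutations, so everything rests on its invariance under `exp (-τ B)`. On diagonal matrices `B`
generates a birth-death chain on a ladder whose upward rates are `q` times the downward ones, with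
`q = d_{k+1}/d_k ≤ 1` (`generator_eq_rateGenerator`). If `z_i / d_i` is ordered like `d`, then `z`
sorted is a sequence `v` with `v (k+1) ≤ q * v k` (`exists_decaying_rearrangement`). By Rado's
theorem the permutohedron is cut out by the total sum and the facets `∑_{i ∈ S} x i ≤ v 0 + … + v
(|S|-1)`. On the facet of `S`, with `|S| = m + 1`, comparison with the neighbouring facets gives `x
i ≥ v m` inside `S` and `x l ≤ v (m+1) ≤ q * v m` outside. As `q * R i l ≤ R l i`, the net flow into
`S` is nonpositive. `euler_step_mem_permutohedron` makes this quantitative for one Euler step, and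
uniformisation passes to the exponential. For the positive `z`, a geometric vector of small ratio
majorises `x₀`. -/

/-! ### Facet inequalities of the permutohedron -/

/-- Abel summation: each drop of `a` multiplies a nonnegative partial sum of `g`. -/
lemma antitone_mul_sum_le {n : ℕ} (a g : Fin (n + 1) → ℝ) (ha : Antitone a)
    (hg : ∀ m (h : m ≤ n + 1), 0 ≤ ∑ i : Fin m, g (Fin.castLE h i)) :
    a (Fin.last n) * ∑ i, g i ≤ ∑ i, a i * g i := by
  induction n with
  | zero => simp
  | succ n ih =>
    have h1 := ih (fun i => a i.castSucc) (fun i => g i.castSucc)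
      (fun i j hij => ha (Fin.castSucc_le_castSucc_iff.2 hij))
      (fun m h => hg m (h.trans (Nat.le_succ _)))
    have h2 := hg (n + 1) (Nat.le_succ _)
    have h3 : a (Fin.last (n + 1)) ≤ a (Fin.last n).castSucc := ha (Fin.le_last _)
    have h4 : 0 ≤ ∑ i : Fin (n + 1), g i.castSucc := h2
    rw [Fin.sum_univ_castSucc, Fin.sum_univ_castSucc (n := n + 1)]
    nlinarith [mul_le_mul_of_nonneg_right h3 h4]

/-- The convex hull of all rearrangements of `z`. -/
def permutohedron {n : ℕ} (z : Fin n → ℝ) : Set (Fin n → ℝ) :=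
  convexHull ℝ (Set.range fun π : Equiv.Perm (Fin n) => permute π z)

lemma isClosed_permutohedron {n : ℕ} (z : Fin n → ℝ) : IsClosed (permutohedron z) :=
  (Set.finite_range _).isClosed_convexHull ℝ

lemma convex_permutohedron {n : ℕ} (z : Fin n → ℝ) : Convex ℝ (permutohedron z) :=
  convex_convexHull ℝ _

lemma permute_mem_permutohedron {n : ℕ} {z x : Fin n → ℝ} (hx : x ∈ permutohedron z)
    (τ : Equiv.Perm (Fin n)) : permute τ x ∈ permutohedron z := by
  let L : (Fin n → ℝ) →ₗ[ℝ] (Fin n → ℝ) := LinearMap.funLeft ℝ ℝ τ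
  have h : permutohedron z ⊆ L ⁻¹' permutohedron z := by
    refine convexHull_min ?_ ((convex_permutohedron z).linear_preimage L)
    rintro _ ⟨π, rfl⟩
    refine subset_convexHull ℝ _ ⟨τ.trans π, ?_⟩
    ext i
    rfl
  exact h hx

/-- Rado's theorem: the inequalities of majorisation describe the convex hull of the
rearrangements. -/
lemma mem_permutohedron_of_sum_le {n : ℕ} {z x : Fin n → ℝ} (v : ℕ → ℝ)
    (π₀ : Equiv.Perm (Fin n)) (hz : ∀ i, z (π₀ i) = v i)
    (hsum : ∑ i, x i = ∑ k ∈ Finset.range n, v k)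
    (hle : ∀ S : Finset (Fin n), ∑ i ∈ S, x i ≤ ∑ k ∈ Finset.range S.card, v k) :
    x ∈ permutohedron z := by
  rcases n with _ | n
  · exact subset_convexHull ℝ _ ⟨1, Subsingleton.elim _ _⟩
  by_contra hx
  obtain ⟨f, u, hf, hu⟩ := geometric_hahn_banach_closed_point
    (convex_permutohedron z) (isClosed_permutohedron z) hx
  let c : Fin (n + 1) → ℝ := fun i => f (Pi.single i 1)
  have hfc : ∀ y : Fin (n + 1) → ℝ, f y = ∑ i, c i * y i := by
    intro y
    conv_lhs => rw [pi_eq_sum_univ' y]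
    simp only [map_sum, map_smul, smul_eq_mul, c]
    refine Finset.sum_congr rfl fun i _ => ?_
    rw [mul_comm]
  let σ : Equiv.Perm (Fin (n + 1)) := Tuple.sort (fun i => - c i)
  have hσ : Antitone fun i => c (σ i) := fun i j hij =>
    neg_le_neg_iff.1 (Tuple.monotone_sort (fun i => - c i) hij)
  -- With the coefficients of the separating functional sorted, the inequality for the set `σ {0, …,
  -- m-1}` says that the `m`-th partial sum is nonnegative.
  have key := antitone_mul_sum_le (fun i => c (σ i)) (fun i => v i - x (σ i)) hσ (by
    intro m h
    have := hle ((Finset.univ : Finset (Fin m)).map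
      ((Fin.castLEEmb h).trans σ.toEmbedding))
    rw [Finset.sum_map, Finset.card_map, Finset.card_univ, Fintype.card_fin,
      ← Fin.sum_univ_eq_sum_range] at this
    simpa [Finset.sum_sub_distrib] using this)
  have h0 : ∑ i : Fin (n + 1), (v i - x (σ i)) = 0 := by
    rw [Finset.sum_sub_distrib, Equiv.sum_comp σ x, hsum, Fin.sum_univ_eq_sum_range, sub_self]
  rw [h0, mul_zero] at key
  -- This vertex pairs `v i` with the `i`-th largest coefficient; by `key` its value under `f` is at
  -- least `f x`, against separation.
  have h1 : f (permute (σ⁻¹.trans π₀) z) < u :=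
    hf _ (subset_convexHull ℝ _ ⟨_, rfl⟩)
  have h2 : f (permute (σ⁻¹.trans π₀) z) = ∑ i, c (σ i) * v i := by
    rw [hfc, ← Equiv.sum_comp σ]
    refine Finset.sum_congr rfl fun i _ => ?_
    simp [permute, hz]
  have h3 : f x = ∑ i, c (σ i) * x (σ i) := by
    rw [hfc, ← Equiv.sum_comp σ]
  simp only [mul_sub, Finset.sum_sub_distrib] at key
  linarith

/-- The two set differences have equally many elements, and `v s.card` separates the values of `v`
on them. -/
lemma sum_le_sum_range_card {v : ℕ → ℝ} (hv : Antitone v) (s : Finset ℕ) :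
    ∑ k ∈ s, v k ≤ ∑ k ∈ Finset.range s.card, v k := by
  rw [← Finset.sum_sdiff_le_sum_sdiff]
  have hcard : (s \ Finset.range s.card).card = (Finset.range s.card \ s).card :=
    Finset.card_sdiff_comm (by simp)
  calc ∑ k ∈ s \ Finset.range s.card, v k ≤ (s \ Finset.range s.card).card • v s.card := by
        refine Finset.sum_le_card_nsmul _ _ _ fun k hk => hv ?_
        simpa using (Finset.mem_sdiff.1 hk).2
    _ = (Finset.range s.card \ s).card • v s.card := by rw [hcard]
    _ ≤ ∑ k ∈ Finset.range s.card \ s, v k := by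
        refine Finset.card_nsmul_le_sum _ _ _ fun k hk => hv ?_
        simpa using (Finset.mem_range.1 (Finset.mem_sdiff.1 hk).1).le

lemma sum_eq_of_mem_permutohedron {n : ℕ} {z x : Fin n → ℝ} (hx : x ∈ permutohedron z) :
    ∑ i, x i = ∑ i, z i := by
  let L : (Fin n → ℝ) →ₗ[ℝ] ℝ := ∑ i, LinearMap.proj i
  have hL : ∀ y, L y = ∑ i, y i := fun y => by simp [L]
  have h : permutohedron z ⊆ L ⁻¹' {∑ i, z i} := by
    refine convexHull_min ?_ ((convex_singleton _).linear_preimage L)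
    rintro _ ⟨π, rfl⟩
    simp only [Set.mem_preimage, hL, Set.mem_singleton_iff]
    exact Equiv.sum_comp π z
  simpa [hL] using h hx

/-- The easy half of Rado's theorem: a linear inequality need only be checked at the vertices. -/
lemma sum_le_of_mem_permutohedron {n : ℕ} {z x : Fin n → ℝ} {v : ℕ → ℝ} (hv : Antitone v)
    {π₀ : Equiv.Perm (Fin n)} (hz : ∀ i, z (π₀ i) = v i) (hx : x ∈ permutohedron z)
    (S : Finset (Fin n)) : ∑ i ∈ S, x i ≤ ∑ k ∈ Finset.range S.card, v k := by
  let L : (Fin n → ℝ) →ₗ[ℝ] ℝ := ∑ i ∈ S, LinearMap.proj i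
  have hL : ∀ y, L y = ∑ i ∈ S, y i := fun y => by simp [L]
  have h : permutohedron z ⊆ L ⁻¹' Set.Iic (∑ k ∈ Finset.range S.card, v k) := by
    refine convexHull_min ?_ ((convex_Iic _).linear_preimage L)
    rintro _ ⟨π, rfl⟩
    simp only [Set.mem_preimage, hL, Set.mem_Iic]
    have h1 := sum_le_sum_range_card hv
      (S.map ((π.trans π₀⁻¹).toEmbedding.trans Fin.valEmbedding))
    rw [Finset.sum_map, Finset.card_map] at h1
    refine le_trans (le_of_eq (Finset.sum_congr rfl fun i _ => ?_)) h1
    simp [permute, ← hz]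
  simpa [hL] using h hx

/-! ### Invariance under one Euler step -/

/-- The generator of the continuous-time Markov chain with jump rate `R i j` from `j` to `i`,
with the sign convention `x' = -B x`. -/
noncomputable def rateGenerator {n : ℕ} (R : Matrix (Fin n) (Fin n) ℝ) : Matrix (Fin n) (Fin n) ℝ :=
  Matrix.diagonal (fun j => ∑ l, R l j) - R

/-- Flows within `S` cancel by antisymmetry; only the exchange with the complement remains. -/
lemma sum_rateGenerator_mulVec {n : ℕ} (R : Matrix (Fin n) (Fin n) ℝ) (x : Fin n → ℝ)
    (S : Finset (Fin n)) :
    ∑ i ∈ S, (rateGenerator R *ᵥ x) i =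
      ∑ i ∈ S, ∑ l ∈ Sᶜ, (R l i * x i - R i l * x l) := by
  have h1 : ∀ i, (rateGenerator R *ᵥ x) i =
      ∑ l ∈ S, (R l i * x i - R i l * x l) + ∑ l ∈ Sᶜ, (R l i * x i - R i l * x l) := by
    intro i
    rw [Finset.sum_add_sum_compl, Finset.sum_sub_distrib, ← Finset.sum_mul]
    rw [rateGenerator, Matrix.sub_mulVec, Pi.sub_apply, Matrix.mulVec_diagonal]
    rfl
  have h2 : ∑ i ∈ S, ∑ l ∈ S, (R l i * x i - R i l * x l) = 0 := by
    simp only [Finset.sum_sub_distrib]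
    rw [Finset.sum_comm, sub_self]
  simp only [h1, Finset.sum_add_distrib, h2, zero_add]

/-- One explicit Euler step for a chain whose rates dominate `q` times the reversed rates keeps
every permutohedron of a vector with geometrically decaying order statistics invariant. -/
lemma euler_step_mem_permutohedron {n : ℕ} {R : Matrix (Fin n) (Fin n) ℝ} {q ε : ℝ}
    (hR : ∀ i j, 0 ≤ R i j) (hq1 : q ≤ 1) (hRq : ∀ i j, q * R i j ≤ R j i)
    (hε : 0 ≤ ε) (hεR : ε * ∑ i, ∑ j, (R i j + R j i) ≤ 1)
    {z : Fin n → ℝ} {v : ℕ → ℝ} {π₀ : Equiv.Perm (Fin n)} (hz : ∀ i, z (π₀ i) = v i)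
    (hv0 : ∀ k, 0 ≤ v k) (hvq : ∀ k, v (k + 1) ≤ q * v k)
    {x : Fin n → ℝ} (hx : x ∈ permutohedron z) :
    (1 - ε • rateGenerator R) *ᵥ x ∈ permutohedron z := by
  have hv : Antitone v := antitone_nat_of_succ_le fun k =>
    (hvq k).trans (mul_le_of_le_one_left (hv0 k) hq1)
  have hzsum : ∑ i, z i = ∑ k ∈ Finset.range n, v k := by
    rw [← Equiv.sum_comp π₀, ← Fin.sum_univ_eq_sum_range]
    exact Finset.sum_congr rfl fun i _ => hz i
  have hxS := sum_le_of_mem_permutohedron hv hz hx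
  have hstep : ∀ S : Finset (Fin n), ∑ i ∈ S, ((1 - ε • rateGenerator R) *ᵥ x) i =
      ∑ i ∈ S, x i + ε * ∑ i ∈ S, ∑ l ∈ Sᶜ, (R i l * x l - R l i * x i) := by
    intro S
    have := sum_rateGenerator_mulVec R x S
    simp only [Matrix.sub_mulVec, Matrix.one_mulVec, Matrix.smul_mulVec, Pi.sub_apply,
      Pi.smul_apply, smul_eq_mul, Finset.sum_sub_distrib, ← Finset.mul_sum] at this ⊢
    rw [this]
    ring
  refine mem_permutohedron_of_sum_le v π₀ hz ?_ fun S => ?_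
  · rw [hstep]
    simp [sum_eq_of_mem_permutohedron hx, hzsum]
  rw [hstep]
  -- The slack `s` measures the distance to the facet of `S`; every estimate valid on the facet
  -- holds up to a multiple of `s`.
  set s := ∑ k ∈ Finset.range S.card, v k - ∑ i ∈ S, x i with hs
  have hs0 : 0 ≤ s := sub_nonneg.2 (hxS S)
  have hflow : ∀ i ∈ S, ∀ l ∈ Sᶜ, R i l * x l - R l i * x i ≤ (R i l + R l i) * s := by
    intro i hi l hl
    obtain ⟨m, hm⟩ : ∃ m, S.card = m + 1 :=
      Nat.exists_eq_succ_of_ne_zero (Finset.card_ne_zero_of_mem hi)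
    have hl' : l ∉ S := by simpa using hl
    -- Removing `i` bounds `x i` from below, adding `l` bounds `x l` from above.
    have h1 := hxS (S.erase i)
    have h2 := hxS (insert l S)
    rw [Finset.card_insert_of_notMem hl', Finset.sum_insert hl', Finset.sum_range_succ] at h2
    rw [Finset.card_erase_of_mem hi, hm, Nat.add_sub_cancel] at h1
    have h3 := Finset.add_sum_erase S x hi
    have h4 : ∑ k ∈ Finset.range S.card, v k = ∑ k ∈ Finset.range m, v k + v m := by
      rw [hm, Finset.sum_range_succ]
    have hxi : v m - s ≤ x i := by linarith
    have hxl : x l ≤ q * v m + s := by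
      have := hvq m
      rw [hm] at h2 hs
      linarith
    have h5 := mul_le_mul_of_nonneg_left hxi (hR l i)
    have h6 := mul_le_mul_of_nonneg_left hxl (hR i l)
    have h7 := mul_le_mul_of_nonneg_right (hRq i l) (hv0 m)
    linarith
  have htotal : ∑ i ∈ S, ∑ l ∈ Sᶜ, (R i l * x l - R l i * x i) ≤
      (∑ i, ∑ j, (R i j + R j i)) * s := by
    have hnn : ∀ i j, 0 ≤ R i j + R j i := fun i j => add_nonneg (hR i j) (hR j i)
    rw [Finset.sum_mul]
    calc _ ≤ ∑ i ∈ S, (∑ j, (R i j + R j i)) * s := by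
          refine Finset.sum_le_sum fun i hi => ?_
          refine (Finset.sum_le_sum (hflow i hi)).trans ?_
          rw [← Finset.sum_mul]
          exact mul_le_mul_of_nonneg_right (Finset.sum_le_sum_of_subset_of_nonneg
            (Finset.subset_univ _) fun j _ _ => hnn i j) hs0
      _ ≤ _ := Finset.sum_le_sum_of_subset_of_nonneg (Finset.subset_univ _) fun i _ _ =>
          mul_nonneg (Finset.sum_nonneg fun j _ => hnn i j) hs0
  -- The inflow during the step is at most `ε * C * s ≤ s`, with `C` the sum of all rates in `hεR`,
  -- so the slack is not exceeded.
  have h8 := mul_le_mul_of_nonneg_left htotal hε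
  have h9 := mul_le_mul_of_nonneg_right hεR hs0
  linarith

/-! ### From Euler steps to the flow and the reachable set -/

section Flow

open Filter Topology
open scoped Matrix.Norms.Operator

lemma exp_smul_mulVec_hasSum {n : ℕ} (P : Matrix (Fin n) (Fin n) ℝ) (l : ℝ) (x : Fin n → ℝ) :
    HasSum (fun k : ℕ => (l ^ k / k.factorial) • (P ^ k *ᵥ x))
      (NormedSpace.exp (l • P) *ᵥ x) := by
  have h := NormedSpace.exp_series_hasSum_exp' (𝕂 := ℝ) (l • P)
  have h2 := h.map ((Matrix.mulVecBilin ℝ ℝ).flip x)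
    (LinearMap.continuous_of_finiteDimensional _)
  convert h2 using 1
  · ext k : 1
    simp [smul_pow, smul_smul, div_eq_inv_mul]
  · rfl

lemma exp_smul_sub_one {n : ℕ} (P : Matrix (Fin n) (Fin n) ℝ) (l : ℝ) :
    NormedSpace.exp (l • (P - 1)) = Real.exp (-l) • NormedSpace.exp (l • P) := by
  have h1 : l • (P - 1) = Matrix.diagonal (fun _ => -l) + l • P := by
    rw [smul_sub, sub_eq_neg_add, ← neg_smul, Matrix.smul_one_eq_diagonal]
  have h2 : NormedSpace.exp (fun _ : Fin n => -l) = fun _ => Real.exp (-l) := by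
    ext i
    rw [Pi.coe_exp, Real.exp_eq_exp_ℝ]
  rw [h1, Matrix.exp_add_of_commute, Matrix.exp_diagonal, h2, ← Matrix.smul_one_eq_diagonal,
    smul_mul_assoc, one_mul]
  rw [← Matrix.smul_one_eq_diagonal]
  exact (Commute.one_left _).smul_left _

/-- Uniformisation: `exp (l • (P - 1))` is the Poisson average of the powers of `P`. The partial
sums, normalised by their own total weight, are convex combinations and converge to it. -/
lemma exp_smul_sub_one_mulVec_mem {n : ℕ} {K : Set (Fin n → ℝ)} (hK : Convex ℝ K)
    (hKc : IsClosed K) {P : Matrix (Fin n) (Fin n) ℝ} (hP : ∀ x ∈ K, P *ᵥ x ∈ K)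
    {l : ℝ} (hl : 0 ≤ l) {x : Fin n → ℝ} (hx : x ∈ K) :
    NormedSpace.exp (l • (P - 1)) *ᵥ x ∈ K := by
  have hpow : ∀ k : ℕ, P ^ k *ᵥ x ∈ K := by
    intro k
    induction k with
    | zero => simpa using hx
    | succ k ih =>
      rw [pow_succ', ← Matrix.mulVec_mulVec]
      exact hP _ ih
  have hw : HasSum (fun k : ℕ => l ^ k / k.factorial) (Real.exp l) := by
    rw [Real.exp_eq_exp_ℝ]
    exact NormedSpace.expSeries_div_hasSum_exp l
  have h1 := (hw.tendsto_sum_nat.inv₀ (Real.exp_pos l).ne').smul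
    (exp_smul_mulVec_hasSum P l x).tendsto_sum_nat
  rw [exp_smul_sub_one, Matrix.smul_mulVec, Real.exp_neg]
  refine hKc.mem_of_tendsto h1 ?_
  filter_upwards [eventually_ge_atTop 1] with N hN
  have hpos : 0 < ∑ k ∈ Finset.range N, l ^ k / (k.factorial : ℝ) := by
    refine Finset.sum_pos' (fun k _ => by positivity) ⟨0, Finset.mem_range.2 hN, by simp⟩
  have := hK.centerMass_mem (t := Finset.range N) (w := fun k : ℕ => l ^ k / (k.factorial : ℝ))
    (z := fun k => P ^ k *ᵥ x) (fun k _ => by positivity) hpos (fun k _ => hpow k)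
  simpa [Finset.centerMass] using this

lemma hasDerivAt_exp_smul_mulVec {n : ℕ} (B : Matrix (Fin n) (Fin n) ℝ) (c : Fin n → ℝ)
    (a s : ℝ) :
    HasDerivAt (fun r : ℝ => NormedSpace.exp (-(r - a) • B) *ᵥ c)
      (-(B *ᵥ (NormedSpace.exp (-(s - a) • B) *ᵥ c))) s := by
  have h1 : HasDerivAt (fun r : ℝ => -(r - a)) (-1) s := ((hasDerivAt_id s).sub_const a).neg
  have h2 := (hasDerivAt_exp_smul_const' (𝕂 := ℝ) B (-(s - a))).scomp s h1
  let L := LinearMap.toContinuousLinearMap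
    ((Matrix.mulVecBilin ℝ ℝ).flip c : Matrix (Fin n) (Fin n) ℝ →ₗ[ℝ] Fin n → ℝ)
  have h3 : -(B *ᵥ (NormedSpace.exp (-(s - a) • B) *ᵥ c)) =
      L ((-1 : ℝ) • (B * NormedSpace.exp (-(s - a) • B))) := by
    rw [map_smul, neg_one_smul, Matrix.mulVec_mulVec]
    rfl
  rw [h3]
  exact L.hasFDerivAt.comp_hasDerivAt s h2

lemma eq_exp_smul_mulVec_of_hasDerivWithinAt {n : ℕ} {B : Matrix (Fin n) (Fin n) ℝ}
    {x : ℝ → Fin n → ℝ} {a b s : ℝ} (hs : s ∈ Set.Ico a b)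
    (hx : ∀ r ∈ Set.Ico a b, HasDerivWithinAt x (-(B *ᵥ x r)) (Set.Ico a b) r) :
    x s = NormedSpace.exp (-(s - a) • B) *ᵥ x a := by
  let L : (Fin n → ℝ) →L[ℝ] (Fin n → ℝ) := LinearMap.toContinuousLinearMap (-(B.mulVecLin))
  have hL : ∀ y, L y = -(B *ᵥ y) := fun y => by simp [L]
  have hsub : Set.Icc a s ⊆ Set.Ico a b := fun r hr => ⟨hr.1, hr.2.trans_lt hs.2⟩
  have hg := hasDerivAt_exp_smul_mulVec B (x a) a
  refine ODE_solution_unique_of_mem_Icc_right (v := fun _ => L) (s := fun _ => Set.univ)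
    (K := ‖L‖₊) (a := a) (b := s) (f := x)
    (g := fun r : ℝ => NormedSpace.exp (-(r - a) • B) *ᵥ x a)
    (fun _ _ => L.lipschitz.lipschitzOnWith)
    (fun r hr => ((hx r (hsub hr)).continuousWithinAt).mono hsub)
    (fun r hr => ?_) (fun _ _ => trivial)
    (fun r _ => (hg r).continuousAt.continuousWithinAt)
    (fun r _ => ?_) (fun _ _ => trivial) (by simp) ⟨hs.1, le_rfl⟩
  · have hr' : r < b := hr.2.trans hs.2
    rw [hL]
    -- As `r < b`, the derivative within `Ico a b` is also a right derivative at `r`, which is what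
    -- ODE uniqueness needs.
    refine (hx r ⟨hr.1, hr'⟩).mono_of_mem_nhdsWithin ?_
    exact mem_nhdsWithin.2 ⟨Set.Iio b, isOpen_Iio, hr', fun u hu => ⟨hr.1.trans hu.2, hu.1⟩⟩
  · rw [hL]
    exact (hg r).hasDerivWithinAt

lemma reach_subset {n : ℕ} {B : Matrix (Fin n) (Fin n) ℝ} {K : Set (Fin n → ℝ)}
    (hperm : ∀ π : Equiv.Perm (Fin n), ∀ x ∈ K, permute π x ∈ K)
    (hflow : ∀ τ : ℝ, 0 ≤ τ → ∀ x ∈ K, NormedSpace.exp (-τ • B) *ᵥ x ∈ K)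
    {x₀ : Fin n → ℝ} (hx₀ : x₀ ∈ K) : reach B x₀ ⊆ K := by
  rintro _ ⟨x, ⟨t, π, y, ht0, hmono, htop, hy0, hy, hx⟩, s, hs, rfl⟩
  have hyK : ∀ k, y k ∈ K := by
    intro k
    induction k with
    | zero => rwa [hy0]
    | succ k ih =>
      rw [hy]
      exact hflow _ (sub_nonneg.2 (hmono k.le_succ)) _ (hperm _ _ ih)
  -- The first switching time beyond `s` exists since the times do not accumulate. The interval
  -- ending there is nonempty, so the conditions on `x` apply.
  obtain ⟨k, hk1, hk2⟩ : ∃ k, t k ≤ s ∧ s < t (k + 1) := by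
    have hex : ∃ m, s < t m := (htop.eventually_gt_atTop s).exists
    have hne : Nat.find hex ≠ 0 := fun h => by
      have := Nat.find_spec hex
      rw [h, ht0] at this
      exact absurd hs (not_le.2 this)
    obtain ⟨k, hk⟩ := Nat.exists_eq_succ_of_ne_zero hne
    refine ⟨k, not_lt.1 (Nat.find_min hex (by omega)), ?_⟩
    have := Nat.find_spec hex
    rwa [hk] at this
  obtain ⟨hxk, hder⟩ := hx k (hk1.trans_lt hk2)
  rw [eq_exp_smul_mulVec_of_hasDerivWithinAt ⟨hk1, hk2⟩ hder, hxk]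
  exact hflow _ (sub_nonneg.2 hk1) _ (hperm _ _ (hyK k))

lemma exp_rateGenerator_mulVec_mem_permutohedron {n : ℕ} {R : Matrix (Fin n) (Fin n) ℝ} {q : ℝ}
    (hR : ∀ i j, 0 ≤ R i j) (hq1 : q ≤ 1) (hRq : ∀ i j, q * R i j ≤ R j i)
    {z : Fin n → ℝ} {v : ℕ → ℝ} {π₀ : Equiv.Perm (Fin n)} (hz : ∀ i, z (π₀ i) = v i)
    (hv0 : ∀ k, 0 ≤ v k) (hvq : ∀ k, v (k + 1) ≤ q * v k) {τ : ℝ} (hτ : 0 ≤ τ)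
    {x : Fin n → ℝ} (hx : x ∈ permutohedron z) :
    NormedSpace.exp (-τ • rateGenerator R) *ᵥ x ∈ permutohedron z := by
  set C := ∑ i, ∑ j, (R i j + R j i)
  have hC : 0 ≤ C := Finset.sum_nonneg fun i _ => Finset.sum_nonneg fun j _ =>
    add_nonneg (hR i j) (hR j i)
  have hC1 : 0 < C + 1 := by linarith
  -- Step size `1 / (C + 1)`; the `+ 1` covers the case where all rates vanish.
  have hstep := fun x hx => euler_step_mem_permutohedron (x := x) hR hq1 hRq
    (inv_nonneg.2 hC1.le) (by rw [inv_mul_le_iff₀ hC1]; linarith) hz hv0 hvq hx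
  have := exp_smul_sub_one_mulVec_mem (convex_permutohedron z) (isClosed_permutohedron z) hstep
    (mul_nonneg hτ hC1.le) hx
  convert this using 3
  rw [sub_sub_cancel_left, smul_neg, smul_smul, mul_assoc, mul_inv_cancel₀ hC1.ne', mul_one,
    neg_smul]

end Flow

/-! ### Majorisation and the permutohedron -/

lemma permMatrix_mulVec_eq_permute {n : ℕ} (π : Equiv.Perm (Fin n)) (z : Fin n → ℝ) :
    π.permMatrix ℝ *ᵥ z = permute π z := by
  rw [Matrix.permMatrix_mulVec]
  rfl

/-- Birkhoff–von Neumann, pushed forward by the linear map `A ↦ A *ᵥ z`. -/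
lemma permutohedron_eq_image {n : ℕ} (z : Fin n → ℝ) :
    permutohedron z = (fun A => A *ᵥ z) '' (doublyStochastic ℝ (Fin n) : Set _) := by
  have h := ((Matrix.mulVecBilin ℝ ℝ).flip z :
    Matrix (Fin n) (Fin n) ℝ →ₗ[ℝ] Fin n → ℝ).image_convexHull
      {σ.permMatrix ℝ | σ : Equiv.Perm (Fin n)}
  rw [← doublyStochastic_eq_convexHull_permMatrix] at h
  refine Eq.trans ?_ h.symm
  rw [permutohedron]
  congr 1
  ext y
  simp [← permMatrix_mulVec_eq_permute]

lemma majorised_iff_mem_permutohedron {n : ℕ} {x z : Fin n → ℝ} :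
    Majorised x z ↔ x ∈ permutohedron z := by
  rw [permutohedron_eq_image]
  rfl

lemma permutohedron_eq_dMajPolytope_one {n : ℕ} (z : Fin n → ℝ) :
    permutohedron z = dMajPolytope (fun _ => 1) z := by
  ext x
  rw [permutohedron_eq_image]
  refine exists_congr fun A => and_congr ?_ Iff.rfl
  have h1 : (∀ j, ∑ i, A i j = 1) ↔ 1 ᵥ* A = 1 := by
    simp [funext_iff, Matrix.vecMul, dotProduct]
  rw [SetLike.mem_coe, mem_doublyStochastic, IsDStochastic, h1, and_comm (a := _ *ᵥ _ = _)]
  rfl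

/-! ### The dissipator on diagonal matrices as a ladder chain -/

/-- The matrix element `⟨i|V|j⟩` in the orthonormal basis `b`. -/
noncomputable def matrixElement {n : ℕ} (b : OrthonormalBasis (Fin n) ℂ (EuclideanSpace ℂ (Fin n)))
    (V : Matrix (Fin n) (Fin n) ℂ) (i j : Fin n) : ℂ :=
  star (b i).ofLp ⬝ᵥ (V *ᵥ (b j).ofLp)

section Dissipator

variable {n : ℕ} (b : OrthonormalBasis (Fin n) ℂ (EuclideanSpace ℂ (Fin n)))

lemma star_dotProduct_basis (i j : Fin n) :
    star (b i).ofLp ⬝ᵥ (b j).ofLp = if i = j then 1 else 0 := by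
  rw [← orthonormal_iff_ite.1 b.orthonormal i j, EuclideanSpace.inner_eq_star_dotProduct,
    dotProduct_comm]

lemma ketBra_mulVec (j k : Fin n) (v : Fin n → ℂ) :
    ketBra b j k *ᵥ v = (star (b k).ofLp ⬝ᵥ v) • (b j).ofLp := by
  rw [ketBra, Matrix.vecMulVec_mulVec]
  ext i
  simp [mul_comm]

lemma matrixElement_ketBra (i j k l : Fin n) :
    matrixElement b (ketBra b k l) i j = if i = k ∧ l = j then 1 else 0 := by
  rw [matrixElement, ketBra_mulVec, star_dotProduct_basis, dotProduct_smul, star_dotProduct_basis]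
  by_cases h1 : i = k <;> by_cases h2 : l = j <;> simp [h1, h2]

lemma star_dotProduct_conjTranspose_mulVec (V : Matrix (Fin n) (Fin n) ℂ) (u v : Fin n → ℂ) :
    star u ⬝ᵥ (Vᴴ *ᵥ v) = star (V *ᵥ u) ⬝ᵥ v := by
  rw [Matrix.dotProduct_mulVec, Matrix.star_mulVec]

/-- Parseval's identity for `V |j⟩` in the basis `b`. -/
lemma star_dotProduct_self_mulVec (V : Matrix (Fin n) (Fin n) ℂ) (j : Fin n) :
    star (V *ᵥ (b j).ofLp) ⬝ᵥ (V *ᵥ (b j).ofLp) =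
      ((∑ l, Complex.normSq (matrixElement b V l j) : ℝ) : ℂ) := by
  let w : EuclideanSpace ℂ (Fin n) := WithLp.toLp 2 (V *ᵥ (b j).ofLp)
  have h := b.sum_inner_mul_inner w w
  have h1 : ∀ l, inner ℂ (b l) w = matrixElement b V l j := fun l => by
    rw [EuclideanSpace.inner_eq_star_dotProduct, dotProduct_comm]
    rfl
  have h2 : inner ℂ w w = star (V *ᵥ (b j).ofLp) ⬝ᵥ (V *ᵥ (b j).ofLp) := by
    rw [EuclideanSpace.inner_eq_star_dotProduct, dotProduct_comm]
  rw [← h2, ← h, Complex.ofReal_sum]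
  refine Finset.sum_congr rfl fun l _ => ?_
  rw [← inner_conj_symm w (b l), h1, Complex.normSq_eq_conj_mul_self]

/-- Thus `V` contributes a Markov generator with jump rate `|⟨i|V|j⟩|²` from `j` to `i`: the
anticommutator gives the total exit rate, `V ρ V†` the jumps. -/
lemma gksl_diagonal_entry (V : Matrix (Fin n) (Fin n) ℂ) (i j : Fin n) :
    star (b i).ofLp ⬝ᵥ (gksl V (ketBra b j j) *ᵥ (b i).ofLp) =
      (((if i = j then ∑ l, Complex.normSq (matrixElement b V l j) else 0) -
        Complex.normSq (matrixElement b V i j) : ℝ) : ℂ) := by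
  have h1 : star (b j).ofLp ⬝ᵥ (Vᴴ *ᵥ (b i).ofLp) = star (matrixElement b V i j) := by
    rw [star_dotProduct_conjTranspose_mulVec, matrixElement, Matrix.star_dotProduct,
      dotProduct_comm]
  have h2 : star (b i).ofLp ⬝ᵥ (V *ᵥ (ketBra b j j *ᵥ (Vᴴ *ᵥ (b i).ofLp))) =
      Complex.normSq (matrixElement b V i j) := by
    rw [ketBra_mulVec, Matrix.mulVec_smul, dotProduct_smul, h1, Complex.normSq_eq_conj_mul_self]
    rfl
  simp only [gksl, Matrix.sub_mulVec, Matrix.smul_mulVec, Matrix.add_mulVec, dotProduct_sub,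
    dotProduct_smul, dotProduct_add, ← Matrix.mulVec_mulVec]
  rw [h2, ketBra_mulVec, ketBra_mulVec, Matrix.mulVec_smul, Matrix.mulVec_smul]
  simp only [dotProduct_smul, star_dotProduct_basis, star_dotProduct_conjTranspose_mulVec]
  by_cases hij : i = j
  · subst hij
    simp only [star_dotProduct_self_mulVec]
    simp only [if_true, smul_eq_mul, Complex.ofReal_sub]
    ring
  · simp [hij, Ne.symm hij]

lemma matrixElement_sum_dite (f : (k : Fin n) → (k : ℕ) + 1 < n → Matrix (Fin n) (Fin n) ℂ)
    (i j : Fin n) :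
    matrixElement b (∑ k : Fin n, if h : (k : ℕ) + 1 < n then f k h else 0) i j =
      ∑ k : Fin n, if h : (k : ℕ) + 1 < n then matrixElement b (f k h) i j else 0 := by
  simp only [matrixElement, Matrix.sum_mulVec, dotProduct_sum]
  refine Finset.sum_congr rfl fun k _ => ?_
  split_ifs <;> simp

lemma matrixElement_smul (c : ℂ) (V : Matrix (Fin n) (Fin n) ℂ) (i j : Fin n) :
    matrixElement b (c • V) i j = c * matrixElement b V i j := by
  simp [matrixElement, Matrix.smul_mulVec]

lemma cos_sq_arccos_rpow {r : ℝ} (hr : 0 ≤ r) :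
    Real.cos (Real.arccos ((1 + r) ^ (-(1 / 2) : ℝ))) ^ 2 = 1 / (1 + r) := by
  have h0 : 0 < 1 + r := by linarith
  have h1 : (0 : ℝ) ≤ (1 + r) ^ (-(1 / 2) : ℝ) := by positivity
  have h2 : (1 + r) ^ (-(1 / 2) : ℝ) ≤ 1 :=
    Real.rpow_le_one_of_one_le_of_nonpos (by linarith) (by norm_num)
  rw [Real.cos_arccos (by linarith) h2, ← Real.rpow_natCast, ← Real.rpow_mul h0.le]
  norm_num [Real.rpow_neg_one]

/-- The jump rates of the ladder `0, …, n - 1` with ratio `q` between upward and downward rates. -/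
noncomputable def ladderRates (n : ℕ) (q : ℝ) : Matrix (Fin n) (Fin n) ℝ :=
  Matrix.of fun i j =>
    if (i : ℕ) + 1 = j then ((i : ℝ) + 1) * ((n : ℝ) - ((i : ℝ) + 1)) * (1 / (1 + q))
    else if (j : ℕ) + 1 = i then ((j : ℝ) + 1) * ((n : ℝ) - ((j : ℝ) + 1)) * (q / (1 + q))
    else 0

lemma ladder_weight_nonneg {k : ℕ} (h : k + 1 ≤ n) :
    0 ≤ ((k : ℝ) + 1) * ((n : ℝ) - ((k : ℝ) + 1)) := by
  have : ((k : ℝ) + 1) ≤ n := by exact_mod_cast h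
  exact mul_nonneg (by positivity) (by linarith)

lemma normSq_matrixElement_sigmaPlus {d : Fin n → ℝ} {q : ℝ} (hq : 0 ≤ q)
    (hd : ∀ (k : ℕ) (h : k + 1 < n), d ⟨k + 1, h⟩ / d ⟨k, by omega⟩ = q) (i j : Fin n) :
    Complex.normSq (matrixElement b (sigmaPlus b d) i j) =
      if (i : ℕ) + 1 = j then ((i : ℝ) + 1) * ((n : ℝ) - ((i : ℝ) + 1)) * (1 / (1 + q))
      else 0 := by
  rw [sigmaPlus, matrixElement_sum_dite, Finset.sum_eq_single i]
  · simp only [matrixElement_smul, matrixElement_ketBra, true_and, Fin.ext_iff]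
    by_cases hij : (i : ℕ) + 1 = j
    · have hi : (i : ℕ) + 1 < n := hij ▸ j.2
      rw [dif_pos hi, if_pos hij, if_pos hij, mul_one, Complex.normSq_ofReal, ← sq, mul_pow,
        Real.sq_sqrt (ladder_weight_nonneg hi.le), thermalAngle, hd i hi, cos_sq_arccos_rpow hq]
    · simp [hij]
  · intro k _ hk
    simp [matrixElement_smul, matrixElement_ketBra, hk.symm]
  · simp

lemma normSq_matrixElement_sigmaMinus {d : Fin n → ℝ} {q : ℝ} (hq : 0 ≤ q)
    (hd : ∀ (k : ℕ) (h : k + 1 < n), d ⟨k + 1, h⟩ / d ⟨k, by omega⟩ = q) (i j : Fin n) :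
    Complex.normSq (matrixElement b (sigmaMinus b d) i j) =
      if (j : ℕ) + 1 = i then ((j : ℝ) + 1) * ((n : ℝ) - ((j : ℝ) + 1)) * (q / (1 + q))
      else 0 := by
  rw [sigmaMinus, matrixElement_sum_dite, Finset.sum_eq_single j]
  · simp only [matrixElement_smul, matrixElement_ketBra, and_true, Fin.ext_iff]
    by_cases hij : (j : ℕ) + 1 = i
    · have hj : (j : ℕ) + 1 < n := hij ▸ i.2
      have h1 : 1 + q ≠ 0 := by linarith
      have h2 : 1 - 1 / (1 + q) = q / (1 + q) := by field_simp; ring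
      rw [dif_pos hj, if_pos hij.symm, if_pos hij, mul_one, Complex.normSq_ofReal, ← sq, mul_pow,
        Real.sq_sqrt (ladder_weight_nonneg hj.le), Real.sin_sq, thermalAngle, hd j hj,
        cos_sq_arccos_rpow hq, h2]
    · simp [hij, Ne.symm hij]
  · intro k _ hk
    simp [matrixElement_smul, matrixElement_ketBra, hk]
  · simp

lemma ladderRates_nonneg {q : ℝ} (hq : 0 ≤ q) (i j : Fin n) : 0 ≤ ladderRates n q i j := by
  rw [ladderRates, Matrix.of_apply]
  split_ifs
  · exact mul_nonneg (ladder_weight_nonneg i.2) (by positivity)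
  · exact mul_nonneg (ladder_weight_nonneg j.2) (by positivity)
  · exact le_rfl

/-- Equality for a downward jump `j → i`; for an upward one the claim reduces to `q² ≤ 1`. -/
lemma mul_ladderRates_le {q : ℝ} (hq : 0 ≤ q) (hq1 : q ≤ 1) (i j : Fin n) :
    q * ladderRates n q i j ≤ ladderRates n q j i := by
  simp only [ladderRates, Matrix.of_apply]
  by_cases h1 : (i : ℕ) + 1 = j
  · have h2 : ¬ (j : ℕ) + 1 = i := by omega
    simp only [h1, h2, if_true, if_false]
    apply le_of_eq
    ring
  by_cases h2 : (j : ℕ) + 1 = i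
  · simp only [h1, h2, if_true, if_false]
    have hw := ladder_weight_nonneg (n := n) (k := j) j.2
    have h3 : q * (q / (1 + q)) ≤ 1 / (1 + q) := by
      rw [← mul_div_assoc]
      exact div_le_div_of_nonneg_right (mul_le_one₀ hq1 hq hq1) (by linarith)
    calc _ = ((j : ℝ) + 1) * ((n : ℝ) - ((j : ℝ) + 1)) * (q * (q / (1 + q))) := by ring
      _ ≤ _ := mul_le_mul_of_nonneg_left h3 hw
  · simp [h1, h2]

end Dissipator

/-! ### Gibbs vectors, the generator and the ordered past cone -/

lemma exists_ratio_gibbs {n : ℕ} {E : Fin n → ℝ} (hmono : Monotone E) (hA : Equidistant E)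
    (T : ℝ≥0∞) : ∃ q : ℝ, 0 < q ∧ q ≤ 1 ∧
      ∀ (k : ℕ) (h : k + 1 < n), gibbs E T ⟨k + 1, h⟩ / gibbs E T ⟨k, by omega⟩ = q := by
  by_cases hn : 1 < n
  · obtain ⟨Δ, hΔ⟩ := hA
    have hΔ0 : 0 ≤ Δ := by
      rw [← hΔ 0 hn]
      exact sub_nonneg.2 (hmono (Fin.mk_le_mk.2 (Nat.zero_le _)))
    refine ⟨Real.exp (-(Δ * T⁻¹.toReal)), Real.exp_pos _, ?_, fun k h => ?_⟩
    · rw [Real.exp_le_one_iff]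
      have := mul_nonneg hΔ0 (ENNReal.toReal_nonneg (a := T⁻¹))
      linarith
    · have hS : 0 < ∑ j, Real.exp (-(E j * T⁻¹.toReal)) :=
        Finset.sum_pos (fun _ _ => Real.exp_pos _) ⟨⟨0, by omega⟩, Finset.mem_univ _⟩
      rw [gibbs, gibbs, div_div_div_cancel_right₀ hS.ne', ← Real.exp_sub, ← hΔ k h]
      congr 1
      ring
  · exact ⟨1, one_pos, le_rfl, fun k h => by omega⟩

lemma gibbs_pos {n : ℕ} (E : Fin n → ℝ) (T : ℝ≥0∞) (k : Fin n) : 0 < gibbs E T k :=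
  div_pos (Real.exp_pos _) (Finset.sum_pos (fun _ _ => Real.exp_pos _) ⟨k, Finset.mem_univ _⟩)

lemma antitone_gibbs {n : ℕ} {E : Fin n → ℝ} (hmono : Monotone E) (T : ℝ≥0∞) :
    Antitone (gibbs E T) := by
  intro i j hij
  have h := mul_le_mul_of_nonneg_right (hmono hij) (ENNReal.toReal_nonneg (a := T⁻¹))
  exact div_le_div_of_nonneg_right (Real.exp_le_exp.2 (neg_le_neg h))
    (Finset.sum_nonneg fun _ _ => (Real.exp_pos _).le)

lemma generator_eq_rateGenerator {n : ℕ}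
    (b : OrthonormalBasis (Fin n) ℂ (EuclideanSpace ℂ (Fin n))) {d : Fin n → ℝ} {q : ℝ}
    (hq : 0 ≤ q) (hd : ∀ (k : ℕ) (h : k + 1 < n), d ⟨k + 1, h⟩ / d ⟨k, by omega⟩ = q) :
    generator b d = rateGenerator (ladderRates n q) := by
  have hR : ∀ i j, Complex.normSq (matrixElement b (sigmaPlus b d) i j) +
      Complex.normSq (matrixElement b (sigmaMinus b d) i j) = ladderRates n q i j := by
    intro i j
    rw [normSq_matrixElement_sigmaPlus b hq hd, normSq_matrixElement_sigmaMinus b hq hd,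
      ladderRates, Matrix.of_apply]
    by_cases h : (i : ℕ) + 1 = j
    · have h' : ¬ (j : ℕ) + 1 = i := by omega
      simp [h, h']
    · simp [h]
  ext i j
  rw [generator, Matrix.of_apply, thermalDissipator, Matrix.add_mulVec, dotProduct_add,
    gksl_diagonal_entry, gksl_diagonal_entry, ← Complex.ofReal_add, Complex.ofReal_re,
    rateGenerator, Matrix.sub_apply, Matrix.diagonal_apply, ← hR i j]
  simp only [← hR, Finset.sum_add_distrib]
  split_ifs with h
  · subst h
    ring
  · ring

/-- A vector of the ordered past cone of a geometric `d` is, up to order, a sequence which decays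
at least as fast as `d`. -/
lemma exists_decaying_rearrangement {n : ℕ} {d z : Fin n → ℝ} {q : ℝ} (hq : 0 ≤ q)
    (hdpos : ∀ k, 0 < d k) (hdanti : Antitone d)
    (hd : ∀ (k : ℕ) (h : k + 1 < n), d ⟨k + 1, h⟩ / d ⟨k, by omega⟩ = q)
    (hz : ∀ i, 0 ≤ z i) (hord : OrderedLikewise d (fun i => z i / d i)) :
    ∃ (v : ℕ → ℝ) (π₀ : Equiv.Perm (Fin n)), (∀ i, z (π₀ i) = v i) ∧ (∀ k, 0 ≤ v k) ∧
      ∀ k, v (k + 1) ≤ q * v k := by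
  obtain ⟨π, h1, h2⟩ := hord
  -- If `d` has ties, `π` need not be the identity, but it leaves `d` unchanged.
  have hdπ : ∀ i, d (π i) = d i := congrFun (Tuple.unique_antitone (f := d) (σ := π) (τ := 1)
    h1 hdanti)
  have hv0 : ∀ k, (0 : ℝ) ≤ if h : k < n then z (π ⟨k, h⟩) else 0 := fun k => by
    split_ifs
    · exact hz _
    · exact le_rfl
  -- Padding by zeros keeps the decay condition true at `k = n - 1` and beyond.
  refine ⟨fun k => if h : k < n then z (π ⟨k, h⟩) else 0, π, fun i => by simp, hv0, fun k => ?_⟩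
  beta_reduce
  by_cases hk : k + 1 < n
  · have h3 := h2 (Fin.mk_le_mk.2 k.le_succ : (⟨k, by omega⟩ : Fin n) ≤ ⟨k + 1, hk⟩)
    simp only [hdπ] at h3
    rw [div_le_div_iff₀ (hdpos _) (hdpos _)] at h3
    rw [dif_pos hk, dif_pos (by omega : k < n), ← hd k hk, div_mul_eq_mul_div,
      le_div_iff₀ (hdpos _)]
    linarith
  · rw [dif_neg hk]
    exact mul_nonneg hq (hv0 k)

/-- A strictly positive probability vector has a strictly positive vector in its ordered past
cone: a geometric one with a sufficiently small ratio. -/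
lemma exists_pos_mem_orderedPastCone {n : ℕ} {d x₀ : Fin n → ℝ} {q : ℝ} (hq : 0 < q)
    (hdpos : ∀ k, 0 < d k) (hdanti : Antitone d)
    (hd : ∀ (k : ℕ) (h : k + 1 < n), d ⟨k + 1, h⟩ / d ⟨k, by omega⟩ = q)
    (hx₀ : x₀ ∈ stdSimplex ℝ (Fin n)) (hpos : ∀ i, 0 < x₀ i) :
    ∃ z ∈ orderedPastCone d x₀, ∀ i, 0 < z i := by
  rcases n with _ | n
  · simpa using hx₀.2
  obtain ⟨i₀, hi₀⟩ := Finite.exists_min x₀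
  have hn : (0 : ℝ) < n + 1 := by positivity
  -- The ratio is at most `q` for the ordering of `z / d`, and so small that any tail of `v`
  -- omitting index `0` has mass at most the least entry of `x₀`.
  set r := min (min q 1) (x₀ i₀ / (n + 1)) with hr
  have hr0 : 0 < r := lt_min (lt_min hq one_pos) (div_pos (hpos i₀) hn)
  have hrq : r ≤ q := (min_le_left _ _).trans (min_le_left _ _)
  have hr1 : r ≤ 1 := (min_le_left _ _).trans (min_le_right _ _)
  have hrx : (n + 1) * r ≤ x₀ i₀ := by
    rw [mul_comm, ← le_div_iff₀ hn]
    exact min_le_right _ _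
  set G := ∑ k ∈ Finset.range (n + 1), r ^ k with hG
  have hG1 : 1 ≤ G := by
    rw [hG, Finset.sum_range_succ']
    have : 0 ≤ ∑ k ∈ Finset.range n, r ^ (k + 1) := Finset.sum_nonneg fun k _ => by positivity
    simpa using this
  have hG0 : 0 < G := by linarith
  let v : ℕ → ℝ := fun k => r ^ k / G
  have hvpos : ∀ k, 0 < v k := fun k => by positivity
  have hvsum : ∑ k ∈ Finset.range (n + 1), v k = 1 := by
    rw [← Finset.sum_div, div_self hG0.ne']
  have hmaj : x₀ ∈ permutohedron fun i : Fin (n + 1) => v i := by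
    refine mem_permutohedron_of_sum_le v 1 (fun i => rfl) (hx₀.2.trans hvsum.symm) fun S => ?_
    rcases S.eq_empty_or_nonempty with rfl | hS
    · simp
    by_cases hSu : S = Finset.univ
    · rw [hSu, hx₀.2, Finset.card_univ, Fintype.card_fin, hvsum]
    obtain ⟨j, hj⟩ : ∃ j, j ∉ S := by
      by_contra! h
      exact hSu (Finset.eq_univ_iff_forall.2 h)
    -- A proper `S` misses at least the mass `x₀ i₀`, which outweighs the tail of `v` from `S.card`
    -- on.
    have h1 : ∑ i ∈ S, x₀ i + x₀ j ≤ 1 := by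
      rw [add_comm, ← Finset.sum_insert hj, ← hx₀.2]
      exact Finset.sum_le_sum_of_subset_of_nonneg (Finset.subset_univ _) fun i _ _ => hx₀.1 i
    have hcard : S.card ≤ n + 1 := by simpa using S.card_le_univ
    have h2 := Finset.sum_range_add_sum_Ico v hcard
    have h3 : ∑ k ∈ Finset.Ico S.card (n + 1), v k ≤ (n + 1) * r := by
      calc _ ≤ (Finset.Ico S.card (n + 1)).card • r := by
            refine Finset.sum_le_card_nsmul _ _ _ fun k hk => ?_
            have hk1 : k ≠ 0 := by
              have := (Finset.mem_Ico.1 hk).1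
              have := hS.card_pos
              omega
            exact (div_le_self (by positivity) hG1).trans (pow_le_of_le_one hr0.le hr1 hk1)
        _ ≤ _ := by
            rw [nsmul_eq_mul, Nat.card_Ico]
            refine mul_le_mul_of_nonneg_right ?_ hr0.le
            exact_mod_cast Nat.sub_le _ _
    have := hi₀ j
    linarith
  refine ⟨fun i => v i, ⟨⟨fun i => (hvpos i).le, ?_⟩, majorised_iff_mem_permutohedron.2 hmaj,
    1, hdanti, ?_⟩, fun i => hvpos i⟩
  · rw [Fin.sum_univ_eq_sum_range v, hvsum]
  -- Consecutive quotients `v k / d k` have ratio `r / q ≤ 1`.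
  · refine Fin.antitone_iff_succ_le.2 fun k => ?_
    have hk := hd k (Nat.succ_lt_succ k.2)
    rw [div_eq_iff (hdpos _).ne'] at hk
    have hk' : d k.succ = q * d k.castSucc := hk
    simp only [Equiv.Perm.coe_one, id, Fin.val_succ, Fin.val_castSucc]
    rw [div_le_div_iff₀ (hdpos _) (hdpos _), hk']
    have h4 : v (k + 1) = r * v k := by simp only [v]; rw [pow_succ]; ring
    rw [h4]
    nlinarith [mul_le_mul_of_nonneg_right hrq (mul_pos (hvpos k) (hdpos k.castSucc)).le]

end ToyModel

theorem mainTheorem2 (n : ℕ)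
    (H₀ : Matrix (Fin n) (Fin n) ℂ) (hH₀ : H₀.IsHermitian)
    (b : OrthonormalBasis (Fin n) ℂ (EuclideanSpace ℂ (Fin n)))
    (E : Fin n → ℝ) (hb : ∀ k, H₀ *ᵥ (b k).ofLp = (E k : ℂ) • (b k).ofLp)
    (hmono : Monotone E) (hA : ToyModel.Equidistant E)
    (T : ℝ≥0∞) (hT : 0 < T)
    (d : Fin n → ℝ) (hd : d = ToyModel.gibbs E T)
    (x₀ : Fin n → ℝ) (hx₀ : x₀ ∈ stdSimplex ℝ (Fin n)) :
    (∀ z ∈ ToyModel.orderedPastCone d x₀,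
      closure (ToyModel.reach (ToyModel.generator b d) x₀) ⊆
          convexHull ℝ (Set.range fun π : Equiv.Perm (Fin n) => ToyModel.permute π z) ∧
        convexHull ℝ (Set.range fun π : Equiv.Perm (Fin n) => ToyModel.permute π z) =
          ToyModel.dMajPolytope (fun _ => 1) z) ∧
    ((∀ i, 0 < x₀ i) → ∃ z ∈ ToyModel.orderedPastCone d x₀, ∀ i, 0 < z i) := by
  obtain ⟨q, hq0, hq1, hratio⟩ := ToyModel.exists_ratio_gibbs hmono hA T
  have hdpos := ToyModel.gibbs_pos E T
  have hdanti := ToyModel.antitone_gibbs hmono T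
  rw [← hd] at hdpos hdanti hratio
  refine ⟨fun z hz => ⟨?_, ToyModel.permutohedron_eq_dMajPolytope_one z⟩,
    ToyModel.exists_pos_mem_orderedPastCone hq0 hdpos hdanti hratio hx₀⟩
  obtain ⟨hzs, hmaj, hord⟩ := hz
  obtain ⟨v, π₀, hv, hv0, hvq⟩ :=
    ToyModel.exists_decaying_rearrangement hq0.le hdpos hdanti hratio hzs.1 hord
  refine closure_minimal ?_ (ToyModel.isClosed_permutohedron z)
  rw [ToyModel.generator_eq_rateGenerator b hq0.le hratio]
  exact ToyModel.reach_subset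
    (fun π x hx => ToyModel.permute_mem_permutohedron hx π)
    (fun τ hτ x hx => ToyModel.exp_rateGenerator_mulVec_mem_permutohedron
      (ToyModel.ladderRates_nonneg hq0.le) hq1 (ToyModel.mul_ladderRates_le hq0.le hq1)
      hv hv0 hvq hτ hx)
    (ToyModel.majorised_iff_mem_permutohedron.1 hmaj)
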